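/- Let $L>0$, $g(x)=\tfrac12(L^2-x^2)$, and let $\bar K<0$ satisfy $\bar K\neq -\dfrac{(2\kappa+1)^2\pi^2}{4L^3}$ for all $\kappa=0,1,2,\dots$. Consider the cascade $$\dot\vartheta(t)=\int_0^L u(y,t)\,dy,\qquad \partial_t u(x,t)=\partial_{xx}u(x,t),\qquad \partial_x u(0,t)=0,\qquad u(L,t)=U(t),$$ for $x\in(0,L)$, $t>0$, in closed loop with the controller $$U(t)=\bar K Z(t),\qquad Z(t)=\vartheta(t)+\int_0^L g(y)u(y,t)\,dy .$$ For a state $(\vartheta,u)$ put $\Omega(t)=|\vartheta(t)|^2+\int_0^L u(x,t)^2\,dx$. Then there are constants $\eta,\nu>0$, depending only on $L$ and $\bar K$, such that for every initial condition $\vartheta(0)=\vartheta_0\in\mathbb R$, $u(\cdot,0)=u_0\in L^2(0,L)$ the closed loop has a unique weak solution $(\vartheta,u)\in C([0,\infty),\mathbb R\times L^2(0,L))$, and it satisfies $$\Omega(t)\le \eta\,\Omega(0)\,e^{-\nu t}\qquad\text{for all } t\ge 0 .$$ Here $(\vartheta,u)\in C([0,\infty),\mathbb R\times L^2(0,L))$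 with the given initial values is a weak solution if $\dot\vartheta(t)=\int_0^L u(y,t)\,dy$ for all $t\ge0$, the weak derivative $\partial_x u$ belongs to $L^2(0,T;L^2(0,L))$ for every $T>0$, the trace of $u(\cdot,t)$ at $x=L$ is $\bar K Z(t)$ for almost every $t>0$, and $$\int_0^L u(x,t)\varphi(x)\,dx-\int_0^L u_0(x)\varphi(x)\,dx=-\int_0^t\!\int_0^L \partial_x u(x,s)\,\varphi'(x)\,dx\,ds$$ for all $t\ge0$ and all $\varphi\in C^1$ with $\varphi(L)=0$. Uniqueness holds even among the very weak solutions: all $(\vartheta,u)\in C([0,\infty),\mathbb R\times L^2(0,L))$ with the same initial values and the same equation for $\vartheta$ such that $$\int_0^L u(x,t)\varphi(x)\,dx-\int_0^L u_0(x)\varphi(x)\,dx=\int_0^t\Big(\int_0^L u(x,s)\varphi''(x)\,dx-\bar K Z(s)\varphi'(L)\Big)ds$$ for all $t\ge0$ and all $\varphi\in C^2$ with $\varphi'(0)=0$ and $\varphi(L)=0$. -/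

import Mathlib

open MeasureTheory Set

namespace HeatCascade

noncomputable section

/-- The Hilbert space `L²(0, L)` of real square integrable functions (modulo equality a.e.). -/
abbrev L2 (L : ℝ) : Type := Lp ℝ 2 (volume.restrict (Ioo (0 : ℝ) L))

/-- The kernel `g(x) = (L² - x²) / 2`. -/
def g (L x : ℝ) : ℝ := (1 / 2) * (L ^ 2 - x ^ 2)

/-- `Z = ϑ + ∫₀ᴸ g(y) u(y) dy`. -/
def Z (L θ : ℝ) (u : L2 L) : ℝ := θ + ∫ y in Ioo 0 L, g L y * u y

/-- `Ω = |ϑ|² + ∫₀ᴸ u(x)² dx`. -/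
def Omega (L θ : ℝ) (u : L2 L) : ℝ := |θ| ^ 2 + ∫ x in Ioo 0 L, (u x) ^ 2

/-- `f ∈ H¹(0, L)`, with weak derivative `f'` and boundary value (trace) `f(L) = a`:
`∫₀ᴸ f ψ' dx + ∫₀ᴸ f' ψ dx = a ψ(L)` for all `C¹` functions `ψ` with `ψ(0) = 0`.
(The functions `ψ` that also vanish at `L` say that `f'` is the weak derivative of `f`,
the others that the boundary value of `f` at `L` is `a`.) -/
def HasWeakDerivWithTrace (L : ℝ) (f f' : L2 L) (a : ℝ) : Prop :=
  ∀ ψ : ℝ → ℝ, ContDiff ℝ 1 ψ → ψ 0 = 0 →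
    (∫ x in Ioo 0 L, f x * deriv ψ x) + ∫ x in Ioo 0 L, f' x * ψ x = a * ψ L

/-- What both notions of solution below have in common: `(ϑ, u) ∈ C([0, ∞), ℝ × L²(0, L))`,
the initial condition, and the equation `ϑ'(t) = ∫₀ᴸ u(y, t) dy` for all `t ≥ 0`
(a one-sided derivative at `t = 0`). Only the values at times `t ≥ 0` matter. -/
structure IsTrajectory (L θ₀ : ℝ) (u₀ : L2 L) (θ : ℝ → ℝ) (u : ℝ → L2 L) : Prop where
  continuousOn_fst : ContinuousOn θ (Ici 0)
  continuousOn_snd : ContinuousOn u (Ici 0)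
  init_fst : θ 0 = θ₀
  init_snd : u 0 = u₀
  ode : ∀ t, 0 ≤ t → HasDerivWithinAt θ (∫ y in Ioo 0 L, u t y) (Ici 0) t

/-- Weak (finite energy) solutions of the closed loop `ϑ' = ∫₀ᴸ u dy`, `u_t = u_xx`,
`u_x(0, t) = 0`, `u(L, t) = K Z(t)`. The function `v` is `u_x ∈ L²(0, T; L²(0, L))`; the
Dirichlet condition at `L` holds in the sense of traces for almost every `t`; the heat equation
with the Neumann condition at `0` is tested, as usual, against all `φ` with `φ(L) = 0`. -/
structure IsWeakSolution (L K θ₀ : ℝ) (u₀ : L2 L) (θ : ℝ → ℝ) (u : ℝ → L2 L) : Prop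
    extends IsTrajectory L θ₀ u₀ θ u where
  heat : ∃ v : ℝ → L2 L,
    (∀ T : ℝ, MemLp v 2 (volume.restrict (Ioo 0 T))) ∧
    (∀ᵐ t ∂(volume.restrict (Ioi (0 : ℝ))),
      HasWeakDerivWithTrace L (u t) (v t) (K * Z L (θ t) (u t))) ∧
    ∀ φ : ℝ → ℝ, ContDiff ℝ 1 φ → φ L = 0 → ∀ t, 0 ≤ t →
      (∫ x in Ioo 0 L, u t x * φ x) - (∫ x in Ioo 0 L, u 0 x * φ x)
        = - ∫ s in (0 : ℝ)..t, ∫ x in Ioo 0 L, v s x * deriv φ x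

/-- Very weak solutions (solutions by transposition) of the same closed loop, for which nothing
beyond `(ϑ, u) ∈ C([0, ∞), ℝ × L²(0, L))` is required of `u`: two integrations by parts in `x`
against `φ` with `φ'(0) = 0` and `φ(L) = 0`. -/
structure IsVeryWeakSolution (L K θ₀ : ℝ) (u₀ : L2 L) (θ : ℝ → ℝ) (u : ℝ → L2 L) : Prop
    extends IsTrajectory L θ₀ u₀ θ u where
  heat : ∀ φ : ℝ → ℝ, ContDiff ℝ 2 φ → deriv φ 0 = 0 → φ L = 0 → ∀ t, 0 ≤ t →
    (∫ x in Ioo 0 L, u t x * φ x) - (∫ x in Ioo 0 L, u 0 x * φ x)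
      = ∫ s in (0 : ℝ)..t,
          ((∫ x in Ioo 0 L, u s x * deriv (deriv φ) x) - K * Z L (θ s) (u s) * deriv φ L)

/-- Every weak solution is a very weak one; so uniqueness of very weak solutions contains
uniqueness of weak solutions. -/
theorem IsWeakSolution.isVeryWeakSolution {L K θ₀ : ℝ} {u₀ : L2 L} {θ : ℝ → ℝ} {u : ℝ → L2 L}
    (h : IsWeakSolution L K θ₀ u₀ θ u) : IsVeryWeakSolution L K θ₀ u₀ θ u where
  toIsTrajectory := h.toIsTrajectory
  heat := by
    intro φ hφ h0 hL t ht
    obtain ⟨v, -, hv, hw⟩ := h.heat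
    have hφ' : ContDiff ℝ 1 (deriv φ) := by
      have h2 : ContDiff ℝ (1 + 1) φ := by simpa [one_add_one_eq_two] using hφ
      exact (contDiff_succ_iff_deriv.1 h2).2.2
    rw [hw φ (hφ.of_le (by norm_num)) hL t ht, ← intervalIntegral.integral_neg]
    apply intervalIntegral.integral_congr_ae
    rw [ae_restrict_iff' measurableSet_Ioi] at hv
    filter_upwards [hv] with s hs hst
    rw [uIoc_of_le ht] at hst
    have := hs hst.1 (deriv φ) hφ' h0
    linarith

end

end HeatCascade

/-!
The kernel `g` satisfies `g'' = -1`, `g'(0) = 0`, `g(L) = 0` and `g'(L) = -L`, so along solutions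
the integral of `u` drops out of `Z'` and `Z' = L K Z`. Hence the boundary input is known in
advance: it is `K Z(0) e^{LKt}`. With `ω² = -L K`, the non-resonance condition says exactly that
`cos (ω L) ≠ 0`, so a multiple of the solution `e^{-ω² t} cos (ω x)` of the heat equation carries
this boundary value. What remains is the heat flow with a homogeneous condition at `L`, which is
diagonal in the orthonormal basis of the functions `cos ((2 k + 1) π x / (2 L))` and decays
exponentially.

Uniqueness of very weak solutions uses the same functions: testing with `g` determines `Z`, and
testing with the cosines then gives a closed linear equation for each coefficient of `u`.
-/

namespace HeatCascade

open Filter Topology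

open scoped RealInnerProductSpace

theorem memLp_Ioo_of_continuous {h : ℝ → ℝ} (hh : Continuous h) (a b : ℝ) (p : ENNReal) :
    MemLp h p (volume.restrict (Ioo a b)) := by
  obtain ⟨C, hC⟩ := isCompact_Icc.exists_bound_of_continuousOn (hh.continuousOn (s := Icc a b))
  refine MemLp.of_bound hh.aestronglyMeasurable C ?_
  filter_upwards [ae_restrict_mem measurableSet_Ioo] with x hx
  exact hC x (Ioo_subset_Icc_self hx)

/-! ### Calculus on the half-line -/

theorem hasDerivAt_cos_mul (ω x : ℝ) :
    HasDerivAt (fun x : ℝ => Real.cos (ω * x)) (-ω * Real.sin (ω * x)) x := by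
  simpa [mul_comm] using ((hasDerivAt_id x).const_mul ω).cos

theorem hasDerivAt_sin_mul (ω x : ℝ) :
    HasDerivAt (fun x : ℝ => Real.sin (ω * x)) (ω * Real.cos (ω * x)) x := by
  simpa [mul_comm] using ((hasDerivAt_id x).const_mul ω).sin

theorem mul_integral_exp_mul (c t : ℝ) :
    c * ∫ s in (0 : ℝ)..t, Real.exp (c * s) = Real.exp (c * t) - 1 := by
  rw [intervalIntegral.mul_integral_comp_mul_left, integral_exp, mul_zero, Real.exp_zero]

theorem hasDerivWithinAt_integral_Ici {E : Type*} [NormedAddCommGroup E] [NormedSpace ℝ E]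
    [CompleteSpace E] {F : ℝ → E} {a t : ℝ} (hF : ContinuousOn F (Ici a)) (ht : a ≤ t) :
    HasDerivWithinAt (fun t => ∫ s in a..t, F s) (F t) (Ici a) t := by
  have hcont : Continuous fun s => F (max s a) :=
    hF.comp_continuous (by fun_prop) fun s => le_max_right s a
  have hderiv := (intervalIntegral.integral_hasDerivAt_right (hcont.intervalIntegrable a t)
    (hcont.stronglyMeasurableAtFilter _ _) hcont.continuousAt).hasDerivWithinAt (s := Ici a)
  rw [max_eq_left ht] at hderiv
  refine hderiv.congr_of_mem (fun x hx => intervalIntegral.integral_congr fun s hs => ?_) ht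
  rw [uIcc_of_le hx] at hs
  exact congrArg F (max_eq_left hs.1).symm

theorem hasDerivWithinAt_of_sub_eq_integral {E : Type*} [NormedAddCommGroup E] [NormedSpace ℝ E]
    [CompleteSpace E] {y F : ℝ → E} {a t : ℝ} (hF : ContinuousOn F (Ici a))
    (hy : ∀ t, a ≤ t → y t - y a = ∫ s in a..t, F s) (ht : a ≤ t) :
    HasDerivWithinAt y (F t) (Ici a) t :=
  ((hasDerivWithinAt_integral_Ici hF ht).add_const (y a)).congr_of_mem
    (fun s hs => sub_eq_iff_eq_add.1 (hy s hs)) ht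

theorem eq_mul_exp_of_hasDerivWithinAt {p : ℝ → ℝ} {c : ℝ}
    (hp : ∀ t, 0 ≤ t → HasDerivWithinAt p (c * p t) (Ici 0) t) {t : ℝ} (ht : 0 ≤ t) :
    p t = p 0 * Real.exp (c * t) := by
  have hq : ∀ s, 0 ≤ s → HasDerivWithinAt (fun s => p s * Real.exp (-c * s)) 0 (Ici 0) s := by
    intro s hs
    have hexp := ((hasDerivAt_id s).const_mul (-c)).exp.hasDerivWithinAt (s := Ici 0)
    refine ((hp s hs).mul hexp).congr_deriv ?_
    simp only [id]
    ring
  have hconst := constant_of_has_deriv_right_zero (a := 0) (b := t)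
    (fun s hs => (hq s hs.1).continuousWithinAt.mono Icc_subset_Ici_self)
    (fun s hs => (hq s hs.1).mono (Ici_subset_Ici.2 hs.1)) t ⟨ht, le_rfl⟩
  simp only [mul_zero, Real.exp_zero, mul_one, neg_mul] at hconst
  rw [← hconst, mul_assoc, ← Real.exp_add, neg_add_cancel, Real.exp_zero, mul_one]

/-! ### Orthonormal series -/

section OrthonormalSeries

variable {ι E : Type*} [NormedAddCommGroup E] [InnerProductSpace ℝ E] {e : ι → E}

theorem summable_smul_of_summable_sq [CompleteSpace E] (he : Orthonormal ℝ e) {a : ι → ℝ}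
    (ha : Summable fun k => a k ^ 2) : Summable fun k => a k • e k := by
  simpa using (he.orthogonalFamily.summable_iff_norm_sq_summable a).2 (by simpa using ha)

theorem hasSum_sq_of_hasSum_smul (he : Orthonormal ℝ e) {a : ι → ℝ} {x : E}
    (hx : HasSum (fun k => a k • e k) x) : HasSum (fun k => a k ^ 2) (‖x‖ ^ 2) := by
  have hnorm : ∀ S : Finset ι, ‖∑ k ∈ S, a k • e k‖ ^ 2 = ∑ k ∈ S, a k ^ 2 := fun S => by
    simpa using he.orthogonalFamily.norm_sum a S
  exact (Tendsto.norm hx |>.pow 2).congr hnorm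

theorem memLp_two_of_hasSum_smul [Countable ι] (he : Orthonormal ℝ e) {α : Type*}
    [MeasurableSpace α] {μ : Measure α} {a : ι → α → ℝ} {F : α → E}
    (ha : ∀ k, MemLp (a k) 2 μ) (hsum : Summable fun k => ∫ t, a k t ^ 2 ∂μ)
    (hF : ∀ᵐ t ∂μ, HasSum (fun k => a k t • e k) (F t)) : MemLp F 2 μ := by
  have hmeas : AEStronglyMeasurable F μ :=
    aestronglyMeasurable_of_tendsto_ae atTop (f := fun (S : Finset ι) t => ∑ k ∈ S, a k t • e k)
      (fun S => Finset.aestronglyMeasurable_fun_sum S fun k _ =>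
        (ha k).aestronglyMeasurable.smul_const (e k)) hF
  have hnonneg : ∀ k, 0 ≤ ∫ t, a k t ^ 2 ∂μ := fun k => integral_nonneg fun t => sq_nonneg _
  refine (memLp_two_iff_integrable_sq_norm hmeas).2 ⟨hmeas.norm.pow 2, ?_⟩
  rw [hasFiniteIntegral_iff_ofReal (ae_of_all _ fun t => sq_nonneg _)]
  calc ∫⁻ t, ENNReal.ofReal (‖F t‖ ^ 2) ∂μ
      = ∫⁻ t, ∑' k, ENNReal.ofReal (a k t ^ 2) ∂μ := lintegral_congr_ae <| by
        filter_upwards [hF] with t ht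
        have hsq := hasSum_sq_of_hasSum_smul he ht
        rw [← hsq.tsum_eq, ENNReal.ofReal_tsum_of_nonneg (fun k => sq_nonneg _) hsq.summable]
    _ = ∑' k, ENNReal.ofReal (∫ t, a k t ^ 2 ∂μ) := by
        rw [lintegral_tsum fun k =>
          (ha k).integrable_sq.aestronglyMeasurable.aemeasurable.ennreal_ofReal]
        exact tsum_congr fun k =>
          (ofReal_integral_eq_lintegral_ofReal (ha k).integrable_sq
            (ae_of_all _ fun t => sq_nonneg _)).symm
    _ = ENNReal.ofReal (∑' k, ∫ t, a k t ^ 2 ∂μ) :=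
        (ENNReal.ofReal_tsum_of_nonneg hnonneg hsum).symm
    _ < ⊤ := ENNReal.ofReal_lt_top

end OrthonormalSeries

/-! ### Diagonal heat semigroups -/

section DiagonalSemigroup

variable {ι E F : Type*} [NormedAddCommGroup E] [InnerProductSpace ℝ E]
  [NormedAddCommGroup F] [InnerProductSpace ℝ F]

/-- The semigroup `e^{-tA}` for the operator `A` with eigenvectors `b k` and eigenvalues
`ω k ^ 2`, applied to `f`; it is only meant for times `t ≥ 0`, where the series converges. -/
noncomputable def diagSemigroup (b : HilbertBasis ι ℝ E) (ω : ι → ℝ) (f : E) (t : ℝ) : E :=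
  ∑' k, (Real.exp (-ω k ^ 2 * t) * b.repr f k) • b k

/-- The flux `D e^{-tA} f` for an operator `D` mapping `b k` to `-ω k • s k`, where `s` is
orthonormal, so that `A = D* D`. Think of `D = d/dx`, of cosines and of sines. The series is only
known to converge for `t > 0`. -/
noncomputable def diagFlux (b : HilbertBasis ι ℝ E) (s : ι → F) (ω : ι → ℝ) (f : E) (t : ℝ) : F :=
  ∑' k, (-ω k * Real.exp (-ω k ^ 2 * t) * b.repr f k) • s k

theorem sq_mul_exp_neg_sq_mul_le (ω : ℝ) {t : ℝ} (ht : 0 < t) :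
    (ω * Real.exp (-ω ^ 2 * t)) ^ 2 ≤ 1 / (2 * t) := by
  have hexp : 2 * t * ω ^ 2 * Real.exp (-(2 * t * ω ^ 2)) ≤ 1 := by
    rw [Real.exp_neg, ← div_eq_mul_inv, div_le_one (Real.exp_pos _)]
    linarith [Real.add_one_le_exp (2 * t * ω ^ 2)]
  rw [mul_pow, ← Real.exp_nat_mul, le_div_iff₀ (by positivity)]
  calc ω ^ 2 * Real.exp ((2 : ℕ) * (-ω ^ 2 * t)) * (2 * t)
      = 2 * t * ω ^ 2 * Real.exp (-(2 * t * ω ^ 2)) := by push_cast; ring_nf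
    _ ≤ 1 := hexp

theorem exp_neg_sq_mul_le_one (ω : ℝ) {t : ℝ} (ht : 0 ≤ t) : Real.exp (-ω ^ 2 * t) ≤ 1 :=
  Real.exp_le_one_iff.2 (mul_nonpos_of_nonpos_of_nonneg (neg_nonpos.2 (sq_nonneg ω)) ht)

variable (b : HilbertBasis ι ℝ E) (ω : ι → ℝ) (f : E)

theorem hasSum_repr_sq : HasSum (fun k => b.repr f k ^ 2) (‖f‖ ^ 2) :=
  hasSum_sq_of_hasSum_smul b.orthonormal (b.hasSum_repr f)

@[simp] theorem diagSemigroup_zero : diagSemigroup b ω f 0 = f := by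
  simpa [diagSemigroup] using (b.hasSum_repr f).tsum_eq

section Semigroup

variable [CompleteSpace E]

theorem hasSum_diagSemigroup {t : ℝ} (ht : 0 ≤ t) :
    HasSum (fun k => (Real.exp (-ω k ^ 2 * t) * b.repr f k) • b k) (diagSemigroup b ω f t) := by
  refine (summable_smul_of_summable_sq b.orthonormal ?_).hasSum
  refine (hasSum_repr_sq b f).summable.of_nonneg_of_le (fun k => sq_nonneg _) fun k => ?_
  rw [mul_pow]
  exact mul_le_of_le_one_left (sq_nonneg _)
    (pow_le_one₀ (Real.exp_pos _).le (exp_neg_sq_mul_le_one _ ht))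

theorem norm_diagSemigroup_le {ω₀ : ℝ} (hω : ∀ k, ω₀ ^ 2 ≤ ω k ^ 2) {t : ℝ} (ht : 0 ≤ t) :
    ‖diagSemigroup b ω f t‖ ≤ Real.exp (-ω₀ ^ 2 * t) * ‖f‖ := by
  refine abs_le_of_sq_le_sq' ?_ (by positivity) |>.2
  rw [mul_pow]
  refine hasSum_le (fun k => ?_)
    (hasSum_sq_of_hasSum_smul b.orthonormal (hasSum_diagSemigroup b ω f ht))
    ((hasSum_repr_sq b f).mul_left _)
  have hexp : Real.exp (-ω k ^ 2 * t) ≤ Real.exp (-ω₀ ^ 2 * t) :=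
    Real.exp_le_exp.2 (mul_le_mul_of_nonneg_right (neg_le_neg (hω k)) ht)
  rw [mul_pow]
  gcongr

theorem hasSum_norm_diagSemigroup_sub_sq {t t₀ : ℝ} (ht : 0 ≤ t) (ht₀ : 0 ≤ t₀) :
    HasSum (fun k => (Real.exp (-ω k ^ 2 * t) - Real.exp (-ω k ^ 2 * t₀)) ^ 2 * b.repr f k ^ 2)
      (‖diagSemigroup b ω f t - diagSemigroup b ω f t₀‖ ^ 2) := by
  refine (hasSum_sq_of_hasSum_smul b.orthonormal (a := fun k =>
    (Real.exp (-ω k ^ 2 * t) - Real.exp (-ω k ^ 2 * t₀)) * b.repr f k) ?_).congr_fun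
    fun k => (mul_pow _ _ 2).symm
  refine ((hasSum_diagSemigroup b ω f ht).sub (hasSum_diagSemigroup b ω f ht₀)).congr_fun
    fun k => ?_
  rw [sub_mul, sub_smul]

theorem continuousOn_diagSemigroup : ContinuousOn (diagSemigroup b ω f) (Ici 0) := by
  intro t₀ ht₀
  have hdom : ∀ t ∈ Ici (0 : ℝ), ∀ k,
      ‖(Real.exp (-ω k ^ 2 * t) - Real.exp (-ω k ^ 2 * t₀)) ^ 2 * b.repr f k ^ 2‖
        ≤ b.repr f k ^ 2 := by
    intro t ht k
    rw [Real.norm_of_nonneg (by positivity)]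
    refine mul_le_of_le_one_left (sq_nonneg _) ((sq_le_one_iff_abs_le_one _).2 ?_)
    exact abs_sub_le_of_nonneg_of_le (Real.exp_pos _).le (exp_neg_sq_mul_le_one _ ht)
      (Real.exp_pos _).le (exp_neg_sq_mul_le_one _ ht₀)
  have hlim : Tendsto (fun t =>
      ∑' k, (Real.exp (-ω k ^ 2 * t) - Real.exp (-ω k ^ 2 * t₀)) ^ 2 * b.repr f k ^ 2)
      (𝓝[Ici 0] t₀) (𝓝 0) := by
    have hterm : ∀ k, Tendsto (fun t =>
        (Real.exp (-ω k ^ 2 * t) - Real.exp (-ω k ^ 2 * t₀)) ^ 2 * b.repr f k ^ 2)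
        (𝓝[Ici 0] t₀) (𝓝 0) := fun k => by
      have hcont : Continuous fun t =>
          (Real.exp (-ω k ^ 2 * t) - Real.exp (-ω k ^ 2 * t₀)) ^ 2 * b.repr f k ^ 2 := by fun_prop
      simpa using (hcont.tendsto t₀).mono_left nhdsWithin_le_nhds
    simpa only [tsum_zero] using tendsto_tsum_of_dominated_convergence
      (hasSum_repr_sq b f).summable hterm (eventually_mem_nhdsWithin.mono hdom)
  rw [ContinuousWithinAt, tendsto_iff_norm_sub_tendsto_zero]
  have hroot := (hlim.congr' (eventually_mem_nhdsWithin.mono fun t (ht : t ∈ Ici 0) =>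
    (hasSum_norm_diagSemigroup_sub_sq b ω f ht ht₀).tsum_eq)).sqrt
  simpa using hroot

end Semigroup

section Flux

variable [CompleteSpace F] {s : ι → F} (hs : Orthonormal ℝ s)
include hs

theorem hasSum_diagFlux {t : ℝ} (ht : 0 < t) :
    HasSum (fun k => (-ω k * Real.exp (-ω k ^ 2 * t) * b.repr f k) • s k)
      (diagFlux b s ω f t) := by
  refine (summable_smul_of_summable_sq hs ?_).hasSum
  refine ((hasSum_repr_sq b f).summable.mul_left (1 / (2 * t))).of_nonneg_of_le
    (fun k => sq_nonneg _) fun k => ?_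
  rw [mul_pow, neg_mul, neg_sq]
  gcongr
  exact sq_mul_exp_neg_sq_mul_le _ ht

theorem memLp_diagFlux [Countable ι] (T : ℝ) :
    MemLp (diagFlux b s ω f) 2 (volume.restrict (Ioo 0 T)) := by
  rcases le_or_gt T 0 with hT | hT
  · simp [Ioo_eq_empty (not_lt.2 hT)]
  have hsum : Summable fun k =>
      ∫ t in Ioo 0 T, (-ω k * Real.exp (-ω k ^ 2 * t) * b.repr f k) ^ 2 := by
    refine (hasSum_repr_sq b f).summable.of_nonneg_of_le
      (fun k => integral_nonneg fun t => sq_nonneg _) fun k => ?_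
    have hexp := mul_integral_exp_mul (-(2 * ω k ^ 2)) T
    calc ∫ t in Ioo 0 T, (-ω k * Real.exp (-ω k ^ 2 * t) * b.repr f k) ^ 2
        = ∫ t in 0..T, ω k ^ 2 * b.repr f k ^ 2 * Real.exp (-(2 * ω k ^ 2) * t) := by
          rw [intervalIntegral.integral_of_le hT.le, integral_Ioc_eq_integral_Ioo]
          refine integral_congr_ae (ae_of_all _ fun t => ?_)
          simp only [mul_pow, ← Real.exp_nat_mul]
          push_cast
          ring_nf
      _ = (1 - Real.exp (-(2 * ω k ^ 2) * T)) / 2 * b.repr f k ^ 2 := by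
          rw [intervalIntegral.integral_const_mul]
          linear_combination (-(b.repr f k ^ 2) / 2) * hexp
      _ ≤ b.repr f k ^ 2 := by
          refine mul_le_of_le_one_left (sq_nonneg _) ?_
          linarith [Real.exp_pos (-(2 * ω k ^ 2) * T)]
  have hmem : ∀ k, MemLp (fun t => -ω k * Real.exp (-ω k ^ 2 * t) * b.repr f k) 2
      (volume.restrict (Ioo 0 T)) := fun k => memLp_Ioo_of_continuous (by fun_prop) 0 T 2
  refine memLp_two_of_hasSum_smul hs hmem hsum ?_
  filter_upwards [ae_restrict_mem measurableSet_Ioo] with t ht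
  exact hasSum_diagFlux b ω f hs ht.1

theorem inner_diagSemigroup_add_inner_diagFlux [CompleteSpace E] {ψ' : E} {ψ : F}
    (hψ : ∀ k, ⟪ψ', b k⟫ = ω k * ⟪ψ, s k⟫) {t : ℝ} (ht : 0 < t) :
    ⟪ψ', diagSemigroup b ω f t⟫ + ⟪ψ, diagFlux b s ω f t⟫ = 0 := by
  refine (((hasSum_diagSemigroup b ω f ht.le).mapL (innerSL ℝ ψ')).add
    ((hasSum_diagFlux b ω f hs ht).mapL (innerSL ℝ ψ))).unique (hasSum_zero.congr_fun fun k => ?_)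
  simp only [innerSL_apply_apply, inner_smul_right, hψ]
  ring

theorem hasSum_integral_inner_diagFlux [Countable ι] {φ : E} {φ' : F}
    (hφ : ∀ k, ⟪φ', s k⟫ = -ω k * ⟪φ, b k⟫) {t : ℝ} (ht : 0 ≤ t) :
    HasSum (fun k => (1 - Real.exp (-ω k ^ 2 * t)) * (⟪φ, b k⟫ * b.repr f k))
      (∫ r in 0..t, ⟪φ', diagFlux b s ω f r⟫) := by
  set c : ι → ℝ := fun k => ⟪φ, b k⟫ * b.repr f k with hc
  have hcsum : Summable fun k => |c k| := by
    simpa only [hc, b.repr_apply_apply] using (b.summable_inner_mul_inner φ f).abs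
  have hint : ∀ (k : ι) (y : ℝ), ∫ r in Ioc 0 t, ω k ^ 2 * Real.exp (-ω k ^ 2 * r) * y
      = (1 - Real.exp (-ω k ^ 2 * t)) * y := by
    intro k y
    rw [← intervalIntegral.integral_of_le ht, intervalIntegral.integral_mul_const,
      intervalIntegral.integral_const_mul]
    linear_combination -y * mul_integral_exp_mul (-ω k ^ 2) t
  have hsum := hasSum_integral_of_summable_integral_norm (μ := volume.restrict (Ioc 0 t))
    (F := fun k r => ω k ^ 2 * Real.exp (-ω k ^ 2 * r) * c k)
    (fun k => (Continuous.intervalIntegrable (by fun_prop) 0 t).1) <| by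
      simp only [norm_mul, norm_pow, Real.norm_eq_abs, sq_abs, Real.abs_exp, hint]
      refine hcsum.of_nonneg_of_le (fun k => ?_) (fun k => ?_)
      · exact mul_nonneg (sub_nonneg.2 (exp_neg_sq_mul_le_one _ ht)) (abs_nonneg _)
      · exact mul_le_of_le_one_left (abs_nonneg _) (sub_le_self _ (Real.exp_pos _).le)
  have hseries : ∀ r ∈ Ioc 0 t, ∑' k, ω k ^ 2 * Real.exp (-ω k ^ 2 * r) * c k
      = ⟪φ', diagFlux b s ω f r⟫ := by
    refine fun r hr => HasSum.tsum_eq ?_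
    refine ((hasSum_diagFlux b ω f hs hr.1).mapL (innerSL ℝ φ')).congr_fun fun k => ?_
    simp only [innerSL_apply_apply, inner_smul_right, hφ, hc]
    ring
  rw [setIntegral_congr_fun measurableSet_Ioc hseries,
    ← intervalIntegral.integral_of_le ht] at hsum
  simpa only [hint] using hsum

theorem inner_diagSemigroup_sub_inner [Countable ι] [CompleteSpace E] {φ : E} {φ' : F}
    (hφ : ∀ k, ⟪φ', s k⟫ = -ω k * ⟪φ, b k⟫) {t : ℝ} (ht : 0 ≤ t) :
    ⟪φ, diagSemigroup b ω f t⟫ - ⟪φ, f⟫ = -∫ r in 0..t, ⟪φ', diagFlux b s ω f r⟫ := by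
  have hsum := ((hasSum_diagSemigroup b ω f ht).mapL (innerSL ℝ φ)).sub
    ((b.hasSum_repr f).mapL (innerSL ℝ φ))
  refine hsum.unique ((hasSum_integral_inner_diagFlux b ω f hs hφ ht).neg.congr_fun fun k => ?_)
  simp only [innerSL_apply_apply, inner_smul_right]
  ring

end Flux

end DiagonalSemigroup

/-! ### Continuous functions as elements of `L²(0, L)` -/

/-- The class in `L²(0, L)` of a continuous function. -/
noncomputable def toL2 (L : ℝ) {h : ℝ → ℝ} (hh : Continuous h) : L2 L :=
  (memLp_Ioo_of_continuous hh 0 L 2).toLp h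

theorem coeFn_toL2 (L : ℝ) {h : ℝ → ℝ} (hh : Continuous h) :
    toL2 L hh =ᵐ[volume.restrict (Ioo (0 : ℝ) L)] h :=
  (memLp_Ioo_of_continuous hh 0 L 2).coeFn_toLp

theorem inner_toL2 (L : ℝ) {h : ℝ → ℝ} (hh : Continuous h) (u : L2 L) :
    ⟪toL2 L hh, u⟫ = ∫ x in Ioo 0 L, u x * h x := by
  rw [L2.inner_def]
  refine integral_congr_ae ?_
  filter_upwards [coeFn_toL2 L hh] with x hx
  simp [hx]

theorem inner_toL2_toL2 {L : ℝ} (hL : 0 ≤ L) {h k : ℝ → ℝ} (hh : Continuous h)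
    (hk : Continuous k) : ⟪toL2 L hh, toL2 L hk⟫ = ∫ x in 0..L, k x * h x := by
  rw [inner_toL2, intervalIntegral.integral_of_le hL, integral_Ioc_eq_integral_Ioo]
  refine integral_congr_ae ?_
  filter_upwards [coeFn_toL2 L hk] with x hx
  rw [hx]

theorem continuous_cos_mul (ω : ℝ) : Continuous fun x : ℝ => Real.cos (ω * x) := by fun_prop

theorem continuous_sin_mul (ω : ℝ) : Continuous fun x : ℝ => Real.sin (ω * x) := by fun_prop

/-- The function `x ↦ cos (ω x)` in `L²(0, L)`. -/
noncomputable def cosL2 (L ω : ℝ) : L2 L := toL2 L (continuous_cos_mul ω)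

/-- The function `x ↦ sin (ω x)` in `L²(0, L)`. -/
noncomputable def sinL2 (L ω : ℝ) : L2 L := toL2 L (continuous_sin_mul ω)

theorem inner_deriv_sinL2 {L : ℝ} (hL : 0 ≤ L) (ω : ℝ) {φ : ℝ → ℝ} (hφ : ContDiff ℝ 1 φ)
    (hφL : φ L = 0) :
    ⟪toL2 L (hφ.continuous_deriv le_rfl), sinL2 L ω⟫
      = -ω * ⟪toL2 L hφ.continuous, cosL2 L ω⟫ := by
  have hd : Continuous (deriv φ) := hφ.continuous_deriv le_rfl
  rw [sinL2, cosL2, inner_toL2_toL2 hL, inner_toL2_toL2 hL,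
    intervalIntegral.integral_mul_deriv_eq_deriv_mul (fun x _ => hasDerivAt_sin_mul ω x)
      (fun x _ => (hφ.differentiable one_ne_zero x).hasDerivAt)
      (Continuous.intervalIntegrable (by fun_prop) _ _) (hd.intervalIntegrable _ _),
    ← intervalIntegral.integral_const_mul]
  simp [hφL, mul_assoc]

theorem inner_deriv_cosL2 {L : ℝ} (hL : 0 ≤ L) (ω : ℝ) {ψ : ℝ → ℝ} (hψ : ContDiff ℝ 1 ψ)
    (hψ0 : ψ 0 = 0) :
    ⟪toL2 L (hψ.continuous_deriv le_rfl), cosL2 L ω⟫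
      = Real.cos (ω * L) * ψ L + ω * ⟪toL2 L hψ.continuous, sinL2 L ω⟫ := by
  have hd : Continuous (deriv ψ) := hψ.continuous_deriv le_rfl
  rw [sinL2, cosL2, inner_toL2_toL2 hL, inner_toL2_toL2 hL,
    intervalIntegral.integral_mul_deriv_eq_deriv_mul (fun x _ => hasDerivAt_cos_mul ω x)
      (fun x _ => (hψ.differentiable one_ne_zero x).hasDerivAt)
      (Continuous.intervalIntegrable (by fun_prop) _ _) (hd.intervalIntegrable _ _),
    ← intervalIntegral.integral_const_mul]
  simp [hψ0, mul_assoc]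

/-! ### Eigenfunctions of the Laplacian, Neumann at `0` and Dirichlet at `L` -/

/-- The frequencies `(2 k + 1) π / (2 L)`, that is, the square roots of the eigenvalues of `-d²/dx²`
on `(0, L)` with a Neumann condition at `0` and a Dirichlet condition at `L`. -/
noncomputable def freq (L : ℝ) (k : ℕ) : ℝ := (2 * k + 1) * (Real.pi / (2 * L))

theorem freq_pos {L : ℝ} (hL : 0 < L) (k : ℕ) : 0 < freq L k := by
  unfold freq; positivity

theorem freq_zero_le {L : ℝ} (hL : 0 < L) (k : ℕ) : freq L 0 ≤ freq L k := by
  unfold freq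
  gcongr
  exact Nat.zero_le k

theorem cos_freq_mul {L : ℝ} (hL : 0 < L) (k : ℕ) : Real.cos (freq L k * L) = 0 := by
  refine Real.cos_eq_zero_iff.2 ⟨k, ?_⟩
  unfold freq
  field_simp
  push_cast
  ring

/-- The `L²`-normalized eigenfunctions `cos (freq L k * x)`. -/
noncomputable def cosMode (L : ℝ) (k : ℕ) : L2 L := (√(L / 2))⁻¹ • cosL2 L (freq L k)

/-- The `L²`-normalized functions `sin (freq L k * x)`, proportional to the derivatives of the
eigenfunctions. -/
noncomputable def sinMode (L : ℝ) (k : ℕ) : L2 L := (√(L / 2))⁻¹ • sinL2 L (freq L k)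

theorem orthonormal_inv_sqrt_smul {ι E : Type*} [DecidableEq ι] [NormedAddCommGroup E]
    [InnerProductSpace ℝ E] {e : ι → E} {c : ℝ} (hc : 0 < c)
    (he : ∀ i j, ⟪e i, e j⟫ = if i = j then c else 0) :
    Orthonormal ℝ fun i => (√c)⁻¹ • e i := by
  rw [orthonormal_iff_ite]
  intro i j
  rw [real_inner_smul_left, real_inner_smul_right, he, ← mul_assoc, ← mul_inv,
    Real.mul_self_sqrt hc.le, mul_ite, mul_zero, inv_mul_cancel₀ hc.ne']

theorem integral_cos_int_mul {L : ℝ} (hL : 0 < L) (m : ℤ) :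
    ∫ x in 0..L, Real.cos (m * (Real.pi / L) * x) = if m = 0 then L else 0 := by
  split_ifs with hm
  · simp [hm]
  · have hfreq : (m : ℝ) * (Real.pi / L) ≠ 0 :=
      mul_ne_zero (Int.cast_ne_zero.2 hm) (div_pos Real.pi_pos hL).ne'
    have hend : (m : ℝ) * (Real.pi / L) * L = m * Real.pi := by field_simp
    rw [intervalIntegral.integral_comp_mul_left Real.cos hfreq, integral_cos, hend]
    simp [Real.sin_int_mul_pi]

theorem integral_cos_freq_sub_freq {L : ℝ} (hL : 0 < L) (j k : ℕ) :
    ∫ x in 0..L, Real.cos (freq L k * x - freq L j * x) = if j = k then L else 0 := by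
  have hint := integral_cos_int_mul hL ((k : ℤ) - j)
  have hphase : ∀ x, freq L k * x - freq L j * x = ((k - j : ℤ) : ℝ) * (Real.pi / L) * x := by
    intro x
    unfold freq
    push_cast
    ring
  simpa only [hphase, sub_eq_zero, Nat.cast_inj, eq_comm (a := k)] using hint

theorem integral_cos_freq_add_freq {L : ℝ} (hL : 0 < L) (j k : ℕ) :
    ∫ x in 0..L, Real.cos (freq L k * x + freq L j * x) = 0 := by
  have hint := integral_cos_int_mul hL ((k : ℤ) + j + 1)
  have hphase : ∀ x, freq L k * x + freq L j * x = ((k + j + 1 : ℤ) : ℝ) * (Real.pi / L) * x := by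
    intro x
    unfold freq
    push_cast
    ring
  simpa only [hphase, if_neg (show (k : ℤ) + j + 1 ≠ 0 by lia)] using hint

theorem inner_cosL2_freq {L : ℝ} (hL : 0 < L) (j k : ℕ) :
    ⟪cosL2 L (freq L j), cosL2 L (freq L k)⟫ = if j = k then L / 2 else 0 := by
  have hprod : ∀ x, Real.cos (freq L k * x) * Real.cos (freq L j * x)
      = 2⁻¹ * (Real.cos (freq L k * x - freq L j * x)
        + Real.cos (freq L k * x + freq L j * x)) := by
    intro x
    linear_combination 2⁻¹ * Real.two_mul_cos_mul_cos (freq L k * x) (freq L j * x)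
  rw [cosL2, cosL2, inner_toL2_toL2 hL.le]
  simp only [hprod]
  rw [intervalIntegral.integral_const_mul, intervalIntegral.integral_add
    (Continuous.intervalIntegrable (by fun_prop) _ _)
    (Continuous.intervalIntegrable (by fun_prop) _ _), integral_cos_freq_sub_freq hL,
    integral_cos_freq_add_freq hL]
  split_ifs <;> ring

theorem inner_sinL2_freq {L : ℝ} (hL : 0 < L) (j k : ℕ) :
    ⟪sinL2 L (freq L j), sinL2 L (freq L k)⟫ = if j = k then L / 2 else 0 := by
  have hprod : ∀ x, Real.sin (freq L k * x) * Real.sin (freq L j * x)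
      = 2⁻¹ * (Real.cos (freq L k * x - freq L j * x)
        - Real.cos (freq L k * x + freq L j * x)) := by
    intro x
    linear_combination 2⁻¹ * Real.two_mul_sin_mul_sin (freq L k * x) (freq L j * x)
  rw [sinL2, sinL2, inner_toL2_toL2 hL.le]
  simp only [hprod]
  rw [intervalIntegral.integral_const_mul, intervalIntegral.integral_sub
    (Continuous.intervalIntegrable (by fun_prop) _ _)
    (Continuous.intervalIntegrable (by fun_prop) _ _), integral_cos_freq_sub_freq hL,
    integral_cos_freq_add_freq hL]
  split_ifs <;> ring

theorem orthonormal_cosMode {L : ℝ} (hL : 0 < L) : Orthonormal ℝ (cosMode L) :=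
  orthonormal_inv_sqrt_smul (half_pos hL) (inner_cosL2_freq hL)

theorem orthonormal_sinMode {L : ℝ} (hL : 0 < L) : Orthonormal ℝ (sinMode L) :=
  orthonormal_inv_sqrt_smul (half_pos hL) (inner_sinL2_freq hL)

/-! ### Completeness of the cosine eigenfunctions -/

section Completeness

variable {α : Type*} [MeasurableSpace α] {μ : Measure α} {v : α → ℝ}

theorem integrable_mul_comp_of_mem_Icc {c : α → ℝ} {a b : ℝ} (hv : Integrable v μ)
    (hc : AEStronglyMeasurable c μ) (hcab : ∀ᵐ x ∂μ, c x ∈ Icc a b) {r : ℝ → ℝ}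
    (hr : Continuous r) : Integrable (fun x => v x * r (c x)) μ := by
  obtain ⟨C, hC⟩ := (isCompact_Icc (a := a) (b := b)).exists_bound_of_continuousOn hr.continuousOn
  exact hv.mul_bdd (hr.comp_aestronglyMeasurable hc) (hcab.mono fun x hx => hC _ hx)

theorem integral_mul_comp_eq_zero_of_forall_pow {c : α → ℝ} {a b : ℝ} (hv : Integrable v μ)
    (hc : AEStronglyMeasurable c μ) (hcab : ∀ᵐ x ∂μ, c x ∈ Icc a b)
    (hpow : ∀ n : ℕ, ∫ x, v x * c x ^ n ∂μ = 0) {r : ℝ → ℝ} (hr : Continuous r) :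
    ∫ x, v x * r (c x) ∂μ = 0 := by
  have hint : ∀ {q : ℝ → ℝ}, Continuous q → Integrable (fun x => v x * q (c x)) μ :=
    integrable_mul_comp_of_mem_Icc hv hc hcab
  have hpoly : ∀ p : Polynomial ℝ, ∫ x, v x * p.eval (c x) ∂μ = 0 := by
    intro p
    simp only [Polynomial.eval_eq_sum_range, Finset.mul_sum, mul_left_comm (v _)]
    rw [integral_finsetSum _ fun n _ => (hint (continuous_pow n)).const_mul _]
    simp only [integral_const_mul, hpow, mul_zero, Finset.sum_const_zero]
  refine norm_eq_zero.1 (le_antisymm (le_of_forall_pos_le_add fun ε hε => ?_) (norm_nonneg _))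
  obtain ⟨p, hp⟩ := exists_polynomial_near_of_continuousOn a b r hr.continuousOn
    (ε / ((∫ x, ‖v x‖ ∂μ) + 1)) (by positivity)
  calc ‖∫ x, v x * r (c x) ∂μ‖
      = ‖∫ x, v x * (p.eval (c x) - r (c x)) ∂μ‖ := by
        simp only [mul_sub]
        rw [integral_sub (hint p.continuous) (hint hr), hpoly, zero_sub, norm_neg]
    _ ≤ ∫ x, ‖v x‖ * (ε / ((∫ x, ‖v x‖ ∂μ) + 1)) ∂μ := by
        refine norm_integral_le_of_norm_le (hv.norm.mul_const _) (hcab.mono fun x hx => ?_)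
        rw [norm_mul]
        gcongr
        exact (hp _ hx).le
    _ = (∫ x, ‖v x‖ ∂μ) * (ε / ((∫ x, ‖v x‖ ∂μ) + 1)) := integral_mul_const _ _
    _ ≤ 0 + ε := by
        rw [mul_div_assoc', div_le_iff₀ (by positivity)]
        linarith

theorem integral_mul_cos_odd_mul_cos_pow_eq_zero {ϑ : α → ℝ} (hv : Integrable v μ)
    (hϑ : AEStronglyMeasurable ϑ μ) (h : ∀ k : ℤ, ∫ x, v x * Real.cos ((2 * k + 1) * ϑ x) ∂μ = 0)
    (n : ℕ) (k : ℤ) :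
    ∫ x, v x * Real.cos ((2 * k + 1) * ϑ x) * Real.cos (2 * ϑ x) ^ n ∂μ = 0 := by
  induction n generalizing k with
  | zero => simpa using h k
  | succ n ih =>
    have hprod : ∀ x, v x * Real.cos ((2 * k + 1) * ϑ x) * Real.cos (2 * ϑ x) ^ (n + 1)
        = 2⁻¹ * (v x * Real.cos ((2 * (k - 1 : ℤ) + 1) * ϑ x) * Real.cos (2 * ϑ x) ^ n
          + v x * Real.cos ((2 * (k + 1 : ℤ) + 1) * ϑ x) * Real.cos (2 * ϑ x) ^ n) := by
      intro x
      have hcos := Real.two_mul_cos_mul_cos ((2 * k + 1) * ϑ x) (2 * ϑ x)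
      rw [show (2 * k + 1) * ϑ x - 2 * ϑ x = (2 * (k - 1 : ℤ) + 1) * ϑ x by push_cast; ring,
        show (2 * k + 1) * ϑ x + 2 * ϑ x = (2 * (k + 1 : ℤ) + 1) * ϑ x by push_cast; ring] at hcos
      linear_combination 2⁻¹ * v x * Real.cos (2 * ϑ x) ^ n * hcos
    have hint : ∀ m : ℤ,
        Integrable (fun x => v x * Real.cos ((2 * m + 1) * ϑ x) * Real.cos (2 * ϑ x) ^ n) μ := by
      intro m
      refine (hv.mul_bdd (c := 1) ?_ (ae_of_all _ fun x => Real.abs_cos_le_one _)).mul_bdd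
        (c := 1) ?_ (ae_of_all _ fun x => ?_)
      · exact Real.continuous_cos.comp_aestronglyMeasurable (hϑ.const_mul (2 * (m : ℝ) + 1))
      · exact (Real.continuous_cos.comp_aestronglyMeasurable (hϑ.const_mul (2 : ℝ))).pow n
      · rw [norm_pow]
        exact pow_le_one₀ (norm_nonneg _) (Real.abs_cos_le_one _)
    simp only [hprod]
    rw [integral_const_mul, integral_add (hint _) (hint _), ih, ih, add_zero, mul_zero]

end Completeness

theorem integral_mul_cos_odd_eq_zero_of_freq {L : ℝ} {v : ℝ → ℝ}
    (h : ∀ k : ℕ, ∫ x in Ioo 0 L, v x * Real.cos (freq L k * x) = 0) (k : ℤ) :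
    ∫ x in Ioo 0 L, v x * Real.cos ((2 * k + 1) * (Real.pi / (2 * L) * x)) = 0 := by
  cases k with
  | ofNat n => simpa [freq, mul_assoc] using h n
  | negSucc n =>
    have hcos : ∀ x, Real.cos ((2 * (Int.negSucc n : ℤ) + 1) * (Real.pi / (2 * L) * x))
        = Real.cos (freq L n * x) := by
      intro x
      rw [← Real.cos_neg, freq]
      push_cast
      ring_nf
    simpa only [hcos] using h n

theorem cos_pi_div_two_mul_pos {L x : ℝ} (hx : x ∈ Ioo 0 L) :
    0 < Real.cos (Real.pi / (2 * L) * x) := by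
  have hL : 0 < L := hx.1.trans hx.2
  have hpos : 0 < Real.pi / (2 * L) * x := mul_pos (by positivity) hx.1
  refine Real.cos_pos_of_mem_Ioo ⟨by linarith [Real.pi_pos], ?_⟩
  calc Real.pi / (2 * L) * x < Real.pi / (2 * L) * L := by gcongr; exact hx.2
    _ = Real.pi / 2 := by field_simp

/- Multiplying by `cos (π x / L)` maps odd modes to odd modes, so `v` times the lowest mode is
orthogonal to all powers of `cos (π x / L)`; by Weierstrass, and since `cos (π x / L)` is injective
on `[0, L]`, it is orthogonal to all continuous functions. -/
theorem ae_eq_zero_of_forall_integral_mul_cos_freq {L : ℝ} (hL : 0 < L) {v : ℝ → ℝ}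
    (hv : IntegrableOn v (Ioo 0 L))
    (h : ∀ k : ℕ, ∫ x in Ioo 0 L, v x * Real.cos (freq L k * x) = 0) :
    v =ᵐ[volume.restrict (Ioo 0 L)] 0 := by
  have hϑ : Continuous fun x => Real.pi / (2 * L) * x := by fun_prop
  set w : ℝ → ℝ := fun x => v x * Real.cos (Real.pi / (2 * L) * x)
  have hw : IntegrableOn w (Ioo 0 L) :=
    hv.mul_bdd (c := 1) (Real.continuous_cos.comp hϑ).aestronglyMeasurable
      (ae_of_all _ fun x => Real.abs_cos_le_one _)
  have hpow : ∀ n : ℕ, ∫ x in Ioo 0 L, w x * Real.cos (2 * (Real.pi / (2 * L) * x)) ^ n = 0 := by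
    intro n
    simpa using integral_mul_cos_odd_mul_cos_pow_eq_zero hv hϑ.aestronglyMeasurable
      (integral_mul_cos_odd_eq_zero_of_freq h) n 0
  have harccos : ∀ x ∈ Ioo 0 L,
      L / Real.pi * Real.arccos (Real.cos (2 * (Real.pi / (2 * L) * x))) = x := by
    intro x hx
    have hangle : 2 * (Real.pi / (2 * L) * x) = x / L * Real.pi := by field_simp
    have hxL : x / L ≤ 1 := (div_le_one hL).2 hx.2.le
    rw [hangle, Real.arccos_cos (mul_nonneg (div_nonneg hx.1.le hL.le) Real.pi_pos.le)
      (mul_le_of_le_one_left Real.pi_pos.le hxL)]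
    field_simp
  have hw0 : ∀ᵐ x ∂volume.restrict (Ioo 0 L), w x = 0 := by
    refine ae_eq_zero_of_integral_contDiff_smul_eq_zero hw.locallyIntegrable fun q hq _ => ?_
    refine (setIntegral_congr_fun measurableSet_Ioo fun x hx => ?_).trans
      (integral_mul_comp_eq_zero_of_forall_pow hw
        (Continuous.aestronglyMeasurable (by fun_prop))
        (ae_of_all _ fun x => Real.cos_mem_Icc (2 * (Real.pi / (2 * L) * x))) hpow
        (r := fun z => q (L / Real.pi * Real.arccos z))
        (hq.continuous.comp (continuous_const.mul Real.continuous_arccos)))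
    rw [harccos x hx, smul_eq_mul, mul_comm]
  filter_upwards [hw0, ae_restrict_mem measurableSet_Ioo] with x hx hxL
  exact (mul_eq_zero.1 hx).resolve_right (cos_pi_div_two_mul_pos hxL).ne'

theorem inner_cosMode (L : ℝ) (k : ℕ) (u : L2 L) :
    ⟪cosMode L k, u⟫ = (√(L / 2))⁻¹ * ∫ x in Ioo 0 L, u x * Real.cos (freq L k * x) := by
  rw [cosMode, real_inner_smul_left, cosL2, inner_toL2]

theorem eq_zero_of_forall_inner_cosMode {L : ℝ} (hL : 0 < L) {u : L2 L}
    (hu : ∀ k : ℕ, ⟪cosMode L k, u⟫ = 0) : u = 0 := by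
  rw [Lp.eq_zero_iff_ae_eq_zero]
  refine ae_eq_zero_of_forall_integral_mul_cos_freq hL
    ((Lp.memLp u).integrable one_le_two) fun k => ?_
  exact (mul_eq_zero.1 ((inner_cosMode L k u).symm.trans (hu k))).resolve_left (by positivity)

/-- The Hilbert basis of `L²(0, L)` consisting of the eigenfunctions `cosMode L k`. -/
noncomputable def cosBasis {L : ℝ} (hL : 0 < L) : HilbertBasis ℕ ℝ (L2 L) :=
  HilbertBasis.mkOfOrthogonalEqBot (orthonormal_cosMode hL) <| by
    rw [Submodule.eq_bot_iff]
    intro u hu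
    exact eq_zero_of_forall_inner_cosMode hL fun k =>
      Submodule.inner_right_of_mem_orthogonal (Submodule.subset_span (mem_range_self k)) hu

theorem cosBasis_apply {L : ℝ} (hL : 0 < L) (k : ℕ) : cosBasis hL k = cosMode L k := by
  rw [cosBasis, HilbertBasis.coe_mkOfOrthogonalEqBot]

/-! ### The heat equation with prescribed boundary value -/

theorem hasWeakDerivWithTrace_iff_inner {L : ℝ} {f f' : L2 L} {a : ℝ} :
    HasWeakDerivWithTrace L f f' a ↔ ∀ (ψ : ℝ → ℝ) (hψ : ContDiff ℝ 1 ψ), ψ 0 = 0 →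
      ⟪toL2 L (hψ.continuous_deriv le_rfl), f⟫ + ⟪toL2 L hψ.continuous, f'⟫ = a * ψ L := by
  simp only [HasWeakDerivWithTrace, inner_toL2]

/-- Finite energy solutions `u` of `u_t = u_xx` on `(0, L)` with `u_x(0, t) = 0` and prescribed
boundary value `u(L, t) = a t`; the function `v` is `u_x`. This is the heat part of
`IsWeakSolution`, with the feedback replaced by an arbitrary input, which makes it linear in
`(u, v, a)`. -/
structure IsHeatSolution (L : ℝ) (u v : ℝ → L2 L) (a : ℝ → ℝ) : Prop where
  continuousOn : ContinuousOn u (Ici 0)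
  memLp_deriv : ∀ T : ℝ, MemLp v 2 (volume.restrict (Ioo 0 T))
  trace : ∀ t, 0 < t → HasWeakDerivWithTrace L (u t) (v t) (a t)
  weak : ∀ (φ : ℝ → ℝ) (hφ : ContDiff ℝ 1 φ), φ L = 0 → ∀ t, 0 ≤ t →
    ⟪toL2 L hφ.continuous, u t⟫ - ⟪toL2 L hφ.continuous, u 0⟫
      = -∫ s in (0 : ℝ)..t, ⟪toL2 L (hφ.continuous_deriv le_rfl), v s⟫

namespace IsHeatSolution

variable {L : ℝ} {u v u' v' : ℝ → L2 L} {a a' : ℝ → ℝ}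

theorem intervalIntegrable_inner_deriv (h : IsHeatSolution L u v a) (w : L2 L) {t : ℝ}
    (ht : 0 ≤ t) : IntervalIntegrable (fun s => ⟪w, v s⟫) volume 0 t := by
  rw [intervalIntegrable_iff_integrableOn_Ioo_of_le ht]
  exact ((h.memLp_deriv t).integrable one_le_two).const_inner w

theorem add (h : IsHeatSolution L u v a) (h' : IsHeatSolution L u' v' a') :
    IsHeatSolution L (fun t => u t + u' t) (fun t => v t + v' t) (fun t => a t + a' t) where
  continuousOn := h.continuousOn.add h'.continuousOn
  memLp_deriv T := (h.memLp_deriv T).add (h'.memLp_deriv T)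
  trace t ht := by
    refine hasWeakDerivWithTrace_iff_inner.2 fun ψ hψ hψ0 => ?_
    have htrace := hasWeakDerivWithTrace_iff_inner.1 (h.trace t ht) ψ hψ hψ0
    have htrace' := hasWeakDerivWithTrace_iff_inner.1 (h'.trace t ht) ψ hψ hψ0
    simp only [inner_add_right]
    linear_combination htrace + htrace'
  weak φ hφ hφL t ht := by
    simp only [inner_add_right]
    rw [intervalIntegral.integral_add (h.intervalIntegrable_inner_deriv _ ht)
      (h'.intervalIntegrable_inner_deriv _ ht)]
    linear_combination h.weak φ hφ hφL t ht + h'.weak φ hφ hφL t ht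

theorem const_smul (h : IsHeatSolution L u v a) (c : ℝ) :
    IsHeatSolution L (fun t => c • u t) (fun t => c • v t) (fun t => c * a t) where
  continuousOn := h.continuousOn.const_smul c
  memLp_deriv T := (h.memLp_deriv T).const_smul c
  trace t ht := by
    refine hasWeakDerivWithTrace_iff_inner.2 fun ψ hψ hψ0 => ?_
    have htrace := hasWeakDerivWithTrace_iff_inner.1 (h.trace t ht) ψ hψ hψ0
    simp only [inner_smul_right]
    linear_combination c * htrace
  weak φ hφ hφL t ht := by
    simp only [inner_smul_right, intervalIntegral.integral_const_mul]
    linear_combination c * h.weak φ hφ hφL t ht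

end IsHeatSolution

theorem isHeatSolution_diagSemigroup {L : ℝ} (hL : 0 < L) (f : L2 L) :
    IsHeatSolution L (diagSemigroup (cosBasis hL) (freq L) f)
      (diagFlux (cosBasis hL) (sinMode L) (freq L) f) (fun _ => 0) where
  continuousOn := continuousOn_diagSemigroup _ _ _
  memLp_deriv := memLp_diagFlux _ _ _ (orthonormal_sinMode hL)
  trace t ht := by
    refine hasWeakDerivWithTrace_iff_inner.2 fun ψ hψ hψ0 => ?_
    rw [zero_mul]
    refine inner_diagSemigroup_add_inner_diagFlux _ _ _ (orthonormal_sinMode hL) (fun k => ?_) ht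
    rw [cosBasis_apply, cosMode, sinMode, inner_smul_right, inner_smul_right,
      inner_deriv_cosL2 hL.le _ hψ hψ0, cos_freq_mul hL]
    ring
  weak φ hφ hφL t ht := by
    rw [diagSemigroup_zero]
    refine inner_diagSemigroup_sub_inner _ _ _ (orthonormal_sinMode hL) (fun k => ?_) ht
    rw [cosBasis_apply, cosMode, sinMode, inner_smul_right, inner_smul_right,
      inner_deriv_sinL2 hL.le _ hφ hφL]
    ring

theorem isHeatSolution_exp_smul_cosL2 {L : ℝ} (hL : 0 ≤ L) (ω : ℝ) :
    IsHeatSolution L (fun t => Real.exp (-ω ^ 2 * t) • cosL2 L ω)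
      (fun t => (-ω * Real.exp (-ω ^ 2 * t)) • sinL2 L ω)
      (fun t => Real.exp (-ω ^ 2 * t) * Real.cos (ω * L)) where
  continuousOn := Continuous.continuousOn (by fun_prop)
  memLp_deriv T := (ContinuousLinearMap.toSpanSingleton ℝ (sinL2 L ω)).comp_memLp'
    (memLp_Ioo_of_continuous (by fun_prop : Continuous fun t => -ω * Real.exp (-ω ^ 2 * t)) 0 T 2)
  trace t _ := by
    refine hasWeakDerivWithTrace_iff_inner.2 fun ψ hψ hψ0 => ?_
    rw [inner_smul_right, inner_smul_right, inner_deriv_cosL2 hL _ hψ hψ0]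
    ring
  weak φ hφ hφL t _ := by
    simp only [inner_smul_right, inner_deriv_sinL2 hL _ hφ hφL, intervalIntegral.integral_mul_const,
      intervalIntegral.integral_const_mul, mul_zero, Real.exp_zero]
    linear_combination -⟪toL2 L hφ.continuous, cosL2 L ω⟫ * mul_integral_exp_mul (-ω ^ 2) t

theorem exists_isHeatSolution_exp {L ω r : ℝ} (hL : 0 < L) (hcos : Real.cos (ω * L) ≠ 0)
    (hrω : r ≤ ω ^ 2) (hr : r ≤ freq L 0 ^ 2) :
    ∃ C : ℝ, ∀ (u₀ : L2 L) (c : ℝ), ∃ u v : ℝ → L2 L,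
      IsHeatSolution L u v (fun t => c * Real.exp (-ω ^ 2 * t)) ∧ u 0 = u₀ ∧
      ∀ t, 0 ≤ t → ‖u t‖ ≤ Real.exp (-r * t) * (‖u₀‖ + C * |c|) := by
  refine ⟨2 * ‖(Real.cos (ω * L))⁻¹ • cosL2 L ω‖, fun u₀ c => ?_⟩
  set w : L2 L := (c / Real.cos (ω * L)) • cosL2 L ω with hw
  have hwnorm : ‖w‖ = ‖(Real.cos (ω * L))⁻¹ • cosL2 L ω‖ * |c| := by
    rw [hw, div_eq_mul_inv, mul_smul, norm_smul, Real.norm_eq_abs, mul_comm]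
  have hsol := (isHeatSolution_diagSemigroup hL (u₀ - w)).add
    ((isHeatSolution_exp_smul_cosL2 hL.le ω).const_smul (c / Real.cos (ω * L)))
  have htrace : ∀ t, 0 + c / Real.cos (ω * L) * (Real.exp (-ω ^ 2 * t) * Real.cos (ω * L))
      = c * Real.exp (-ω ^ 2 * t) := by
    intro t
    field_simp
    ring
  simp only [htrace] at hsol
  refine ⟨_, _, hsol, by simp [hw], fun t ht => ?_⟩
  rw [smul_comm]
  have hexp : ∀ {s : ℝ}, r ≤ s → Real.exp (-s * t) ≤ Real.exp (-r * t) := fun hs =>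
    Real.exp_le_exp.2 (mul_le_mul_of_nonneg_right (neg_le_neg hs) ht)
  have hfreq : ∀ k, freq L 0 ^ 2 ≤ freq L k ^ 2 := fun k =>
    pow_le_pow_left₀ (freq_pos hL 0).le (freq_zero_le hL k) 2
  calc ‖diagSemigroup (cosBasis hL) (freq L) (u₀ - w) t + Real.exp (-ω ^ 2 * t) • w‖
      ≤ Real.exp (-freq L 0 ^ 2 * t) * ‖u₀ - w‖ + Real.exp (-ω ^ 2 * t) * ‖w‖ := by
        refine norm_add_le_of_le (norm_diagSemigroup_le _ _ _ hfreq ht) ?_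
        rw [norm_smul, Real.norm_eq_abs, Real.abs_exp]
    _ ≤ Real.exp (-r * t) * (‖u₀‖ + ‖w‖) + Real.exp (-r * t) * ‖w‖ := by
        gcongr ?_ * ?_ + ?_ * ‖w‖
        · exact hexp hr
        · exact norm_sub_le u₀ w
        · exact hexp hrω
    _ = Real.exp (-r * t) * (‖u₀‖ + 2 * ‖(Real.cos (ω * L))⁻¹ • cosL2 L ω‖ * |c|) := by
        rw [hwnorm]
        ring

/-! ### The kernel `g` and the variable `Z` -/

theorem contDiff_g (L : ℝ) {n : WithTop ℕ∞} : ContDiff ℝ n (g L) := by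
  unfold g; fun_prop

theorem deriv_g (L : ℝ) : deriv (g L) = fun x => -x := by
  funext x
  exact (((hasDerivAt_pow 2 x).const_sub (L ^ 2)).const_mul (1 / 2)).deriv.trans
    (by push_cast; ring)

theorem deriv_deriv_g (L : ℝ) : deriv (deriv (g L)) = fun _ => -1 := by
  rw [deriv_g, deriv_neg']

theorem g_self (L : ℝ) : g L L = 0 := by simp [g]

/-- The kernel `g` as an element of `L²(0, L)`. -/
noncomputable def gL2 (L : ℝ) : L2 L := toL2 L (contDiff_g L (n := 1)).continuous

theorem Z_eq (L θ : ℝ) (u : L2 L) : Z L θ u = θ + ∫ x in Ioo 0 L, u x * g L x := by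
  simp only [Z, mul_comm]

theorem Z_eq_add_inner (L θ : ℝ) (u : L2 L) : Z L θ u = θ + ⟪gL2 L, u⟫ := by
  rw [Z_eq, gL2, inner_toL2]

theorem continuousOn_integral_mul {X : Type*} [TopologicalSpace X] {L : ℝ} {u : X → L2 L}
    {S : Set X} (hu : ContinuousOn u S) {φ : ℝ → ℝ} (hφ : Continuous φ) :
    ContinuousOn (fun t => ∫ x in Ioo 0 L, u t x * φ x) S := by
  simp only [← inner_toL2 L hφ]
  exact continuousOn_const.inner hu

theorem continuousOn_Z {X : Type*} [TopologicalSpace X] {L : ℝ} {θ : X → ℝ} {u : X → L2 L}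
    {S : Set X} (hθ : ContinuousOn θ S) (hu : ContinuousOn u S) :
    ContinuousOn (fun t => Z L (θ t) (u t)) S := by
  simp only [Z_eq_add_inner]
  exact hθ.add (continuousOn_const.inner hu)

/-! ### Closing the loop -/

namespace IsHeatSolution

variable {L : ℝ} {u v : ℝ → L2 L}

theorem hasDerivWithinAt_inner_gL2 {a : ℝ → ℝ} (h : IsHeatSolution L u v a)
    (ha : ContinuousOn a (Ici 0)) {t : ℝ} (ht : 0 ≤ t) :
    HasDerivWithinAt (fun t => ⟪gL2 L, u t⟫) (L * a t - ∫ x in Ioo 0 L, u t x) (Ici 0) t := by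
  have hmean : ContinuousOn (fun t => ∫ x in Ioo 0 L, u t x) (Ici 0) := by
    simpa using continuousOn_integral_mul h.continuousOn (continuous_const (y := (1 : ℝ)))
  have hcont : ContinuousOn (fun t => L * a t - ∫ x in Ioo 0 L, u t x) (Ici 0) :=
    (continuousOn_const.mul ha).sub hmean
  refine hasDerivWithinAt_of_sub_eq_integral hcont (fun t ht => ?_) ht
  refine (h.weak (g L) (contDiff_g L) (g_self L) t ht).trans ?_
  rw [← intervalIntegral.integral_neg]
  refine intervalIntegral.integral_congr_ae (ae_of_all _ fun s hs => ?_)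
  rw [uIoc_of_le ht] at hs
  have htrace := h.trace s hs.1 (deriv (g L)) (by rw [deriv_g]; exact contDiff_neg)
    (by simp [deriv_g])
  rw [deriv_deriv_g] at htrace
  rw [deriv_g] at htrace
  rw [inner_toL2, deriv_g]
  simp only [mul_neg, mul_one, integral_neg] at htrace ⊢
  linear_combination -htrace

/-- With the boundary value `K * z`, where `z` solves `z' = L K z`, the state `θ` is recovered from
`z = θ + ⟪g, u⟫`. -/
theorem isWeakSolution {K θ₀ : ℝ}
    (h : IsHeatSolution L u v fun t => K * (Z L θ₀ (u 0) * Real.exp (L * K * t))) :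
    IsWeakSolution L K θ₀ (u 0)
      (fun t => Z L θ₀ (u 0) * Real.exp (L * K * t) - ⟪gL2 L, u t⟫) u := by
  have hz : ∀ t, HasDerivAt (fun t => Z L θ₀ (u 0) * Real.exp (L * K * t))
      (L * (K * (Z L θ₀ (u 0) * Real.exp (L * K * t)))) t := fun t =>
    (((hasDerivAt_id t).const_mul (L * K)).exp.const_mul (Z L θ₀ (u 0))).congr_deriv
      (by simp only [id]; ring)
  have hθ : ∀ t, 0 ≤ t → HasDerivWithinAt
      (fun t => Z L θ₀ (u 0) * Real.exp (L * K * t) - ⟪gL2 L, u t⟫)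
      (∫ x in Ioo 0 L, u t x) (Ici 0) t := fun t ht =>
    ((hz t).hasDerivWithinAt.sub (h.hasDerivWithinAt_inner_gL2
      (Continuous.continuousOn (by fun_prop)) ht)).congr_deriv (sub_sub_cancel _ _)
  refine ⟨⟨fun t ht => (hθ t ht).continuousWithinAt, h.continuousOn, ?_, rfl, hθ⟩,
    v, h.memLp_deriv, ?_, fun φ hφ hφL t ht => ?_⟩
  · simp [Z_eq_add_inner]
  · filter_upwards [ae_restrict_mem measurableSet_Ioi] with t ht
    rw [Z_eq_add_inner, sub_add_cancel]
    exact h.trace t ht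
  · simpa only [inner_toL2] using h.weak φ hφ hφL t ht

end IsHeatSolution

theorem cos_sqrt_mul_ne_zero {L K : ℝ} (hL : 0 < L) (hK : K < 0)
    (hK' : ∀ κ : ℕ, K ≠ -((2 * (κ : ℝ) + 1) ^ 2 * Real.pi ^ 2 / (4 * L ^ 3))) :
    Real.cos (√(-(L * K)) * L) ≠ 0 := by
  intro hcos
  obtain ⟨m, hm⟩ := Real.cos_eq_zero_iff.1 hcos
  have hm_nonneg : 0 ≤ m := by
    have hpos : 0 < (2 * (m : ℝ) + 1) * Real.pi := by
      linarith [mul_pos (Real.sqrt_pos.2 (neg_pos.2 (mul_neg_of_pos_of_neg hL hK))) hL]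
    have hodd : (0 : ℝ) < 2 * m + 1 := pos_of_mul_pos_left hpos Real.pi_pos.le
    have : 0 < 2 * m + 1 := mod_cast hodd
    lia
  lift m to ℕ using hm_nonneg
  have hsq : -(L * K) * L ^ 2 = ((2 * (m : ℝ) + 1) * Real.pi / 2) ^ 2 := by
    rw [← Real.sq_sqrt (neg_pos.2 (mul_neg_of_pos_of_neg hL hK)).le, ← mul_pow, hm,
      Int.cast_natCast]
  refine hK' m ?_
  field_simp
  linear_combination -4 * hsq

/-! ### Exponential decay -/

theorem Omega_eq (L θ : ℝ) (u : L2 L) : Omega L θ u = θ ^ 2 + ‖u‖ ^ 2 := by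
  rw [Omega, sq_abs, ← real_inner_self_eq_norm_sq, L2.inner_def]
  simp [sq]

theorem add_inner_sq_add_norm_sq_le {E : Type*} [NormedAddCommGroup E] [InnerProductSpace ℝ E]
    (z : ℝ) (x y : E) :
    (z + ⟪x, y⟫) ^ 2 + ‖y‖ ^ 2 ≤ 2 * (1 + ‖x‖ ^ 2) * (z ^ 2 + ‖y‖ ^ 2) := by
  have hinner : ⟪x, y⟫ ^ 2 ≤ ‖x‖ ^ 2 * ‖y‖ ^ 2 := by
    rw [← mul_pow, ← sq_abs]
    gcongr
    exact abs_real_inner_le_norm x y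
  linarith [add_sq_le (a := z) (b := ⟪x, y⟫), mul_nonneg (sq_nonneg ‖x‖) (sq_nonneg z),
    sq_nonneg ‖y‖]

theorem Omega_le_of_abs_Z_le {L B E θ₀ θ : ℝ} {u₀ u : L2 L}
    (hZ : |Z L θ u| ≤ E * |Z L θ₀ u₀|) (hu : ‖u‖ ≤ E * (‖u₀‖ + B * |Z L θ₀ u₀|)) :
    Omega L θ u
      ≤ (2 * (1 + ‖gL2 L‖ ^ 2)) ^ 2 * (2 * (1 + B ^ 2)) * Omega L θ₀ u₀ * E ^ 2 := by
  have hfrom : Omega L θ u ≤ 2 * (1 + ‖gL2 L‖ ^ 2) * (Z L θ u ^ 2 + ‖u‖ ^ 2) := by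
    simpa [Omega_eq, Z_eq_add_inner] using add_inner_sq_add_norm_sq_le (Z L θ u) (-gL2 L) u
  have hto : Z L θ₀ u₀ ^ 2 + ‖u₀‖ ^ 2 ≤ 2 * (1 + ‖gL2 L‖ ^ 2) * Omega L θ₀ u₀ := by
    rw [Omega_eq, Z_eq_add_inner]
    exact add_inner_sq_add_norm_sq_le θ₀ (gL2 L) u₀
  have hsum : Z L θ u ^ 2 + ‖u‖ ^ 2
      ≤ E ^ 2 * (2 * (1 + B ^ 2)) * (Z L θ₀ u₀ ^ 2 + ‖u₀‖ ^ 2) := by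
    calc Z L θ u ^ 2 + ‖u‖ ^ 2
        ≤ (E * |Z L θ₀ u₀|) ^ 2 + (E * (‖u₀‖ + B * |Z L θ₀ u₀|)) ^ 2 := by
          rw [← sq_abs (Z L θ u)]
          gcongr
      _ ≤ E ^ 2 * (2 * (1 + B ^ 2)) * (|Z L θ₀ u₀| ^ 2 + ‖u₀‖ ^ 2) := by
          nlinarith [mul_nonneg (sq_nonneg E) (sq_nonneg (‖u₀‖ - B * |Z L θ₀ u₀|)),
            mul_nonneg (sq_nonneg E) (sq_nonneg (B * ‖u₀‖)),
            mul_nonneg (sq_nonneg E) (sq_nonneg |Z L θ₀ u₀|)]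
      _ = _ := by rw [sq_abs]
  calc Omega L θ u ≤ 2 * (1 + ‖gL2 L‖ ^ 2) * (Z L θ u ^ 2 + ‖u‖ ^ 2) := hfrom
    _ ≤ 2 * (1 + ‖gL2 L‖ ^ 2)
        * (E ^ 2 * (2 * (1 + B ^ 2)) * (2 * (1 + ‖gL2 L‖ ^ 2) * Omega L θ₀ u₀)) := by
      gcongr
      exact hsum.trans (by gcongr)
    _ = _ := by ring

theorem exists_isWeakSolution_Omega_le {L K : ℝ} (hL : 0 < L) (hK : K < 0)
    (hcos : Real.cos (√(-(L * K)) * L) ≠ 0) :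
    ∃ η : ℝ, 0 < η ∧ ∃ ν : ℝ, 0 < ν ∧ ∀ (θ₀ : ℝ) (u₀ : L2 L), ∃ (θ : ℝ → ℝ) (u : ℝ → L2 L),
      IsWeakSolution L K θ₀ u₀ θ u ∧
      ∀ t, 0 ≤ t → Omega L (θ t) (u t) ≤ η * Omega L θ₀ u₀ * Real.exp (-ν * t) := by
  have hLK : 0 < -(L * K) := neg_pos.2 (mul_neg_of_pos_of_neg hL hK)
  have hω : √(-(L * K)) ^ 2 = -(L * K) := Real.sq_sqrt hLK.le
  set r : ℝ := min (-(L * K)) (freq L 0 ^ 2)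
  have hr_pos : 0 < r := lt_min hLK (pow_pos (freq_pos hL 0) 2)
  obtain ⟨C, hC⟩ := exists_isHeatSolution_exp hL hcos
    ((min_le_left _ _).trans_eq hω.symm : r ≤ _) (min_le_right _ _)
  refine ⟨(2 * (1 + ‖gL2 L‖ ^ 2)) ^ 2 * (2 * (1 + (C * |K|) ^ 2)), by positivity, 2 * r,
    by positivity, fun θ₀ u₀ => ?_⟩
  obtain ⟨u, v, hsol, rfl, hu⟩ := hC u₀ (K * Z L θ₀ u₀)
  simp only [hω, neg_neg, mul_assoc K] at hsol
  refine ⟨_, u, hsol.isWeakSolution, fun t ht => ?_⟩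
  have hexp : Real.exp (-(2 * r) * t) = Real.exp (-r * t) ^ 2 := by
    rw [← Real.exp_nat_mul]
    push_cast
    ring_nf
  rw [hexp]
  refine Omega_le_of_abs_Z_le ?_ ?_
  · rw [Z_eq_add_inner, sub_add_cancel, abs_mul, Real.abs_exp, mul_comm]
    gcongr
    linarith [min_le_left (-(L * K)) (freq L 0 ^ 2)]
  · simpa only [abs_mul, mul_assoc] using hu t ht

/-! ### Uniqueness -/

namespace IsVeryWeakSolution

variable {L K θ₀ : ℝ} {u₀ : L2 L} {θ θ' : ℝ → ℝ} {u u' : ℝ → L2 L}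

theorem hasDerivWithinAt_integral_mul (h : IsVeryWeakSolution L K θ₀ u₀ θ u) {φ : ℝ → ℝ}
    (hφ : ContDiff ℝ 2 φ) (hφ0 : deriv φ 0 = 0) (hφL : φ L = 0) {t : ℝ} (ht : 0 ≤ t) :
    HasDerivWithinAt (fun t => ∫ x in Ioo 0 L, u t x * φ x)
      ((∫ x in Ioo 0 L, u t x * deriv (deriv φ) x) - K * Z L (θ t) (u t) * deriv φ L)
      (Ici 0) t := by
  have hφ'' : Continuous (deriv (deriv φ)) :=
    (contDiff_succ_iff_deriv.1 (by simpa [one_add_one_eq_two] using hφ :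
      ContDiff ℝ (1 + 1) φ)).2.2.continuous_deriv le_rfl
  have hZ := continuousOn_Z h.continuousOn_fst h.continuousOn_snd
  exact hasDerivWithinAt_of_sub_eq_integral
    ((continuousOn_integral_mul h.continuousOn_snd hφ'').sub
      ((continuousOn_const.mul hZ).mul continuousOn_const)) (h.heat φ hφ hφ0 hφL) ht

/-- The kernel `g` is chosen so that `Z' = L K Z`: the integral of `u` contributed by `θ'` cancels
the one contributed by `g'' = -1`. -/
theorem Z_eq_mul_exp (h : IsVeryWeakSolution L K θ₀ u₀ θ u) {t : ℝ} (ht : 0 ≤ t) :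
    Z L (θ t) (u t) = Z L θ₀ u₀ * Real.exp (L * K * t) := by
  have hode : ∀ t, 0 ≤ t → HasDerivWithinAt (fun t => Z L (θ t) (u t))
      (L * K * Z L (θ t) (u t)) (Ici 0) t := by
    intro t ht
    have hsum := (h.ode t ht).add
      (h.hasDerivWithinAt_integral_mul (contDiff_g L) (by simp [deriv_g]) (g_self L) ht)
    simp only [Z_eq L (θ _)]
    refine hsum.congr_deriv ?_
    rw [deriv_deriv_g, deriv_g]
    simp only [mul_neg, mul_one, integral_neg, Z_eq]
    ring
  rw [eq_mul_exp_of_hasDerivWithinAt hode ht, h.init_fst, h.init_snd]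

theorem hasDerivWithinAt_integral_mul_cos_freq (h : IsVeryWeakSolution L K θ₀ u₀ θ u) (hL : 0 < L)
    (k : ℕ) {t : ℝ} (ht : 0 ≤ t) :
    HasDerivWithinAt (fun t => ∫ x in Ioo 0 L, u t x * Real.cos (freq L k * x))
      (-freq L k ^ 2 * (∫ x in Ioo 0 L, u t x * Real.cos (freq L k * x))
        + K * Z L (θ t) (u t) * (freq L k * Real.sin (freq L k * L))) (Ici 0) t := by
  have hderiv : deriv (fun x => Real.cos (freq L k * x))
      = fun x => -freq L k * Real.sin (freq L k * x) :=
    funext fun x => (hasDerivAt_cos_mul _ x).deriv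
  have hderiv2 : deriv (deriv fun x => Real.cos (freq L k * x))
      = fun x => -freq L k * (freq L k * Real.cos (freq L k * x)) := by
    rw [hderiv]
    exact funext fun x => ((hasDerivAt_sin_mul _ x).const_mul _).deriv
  refine (h.hasDerivWithinAt_integral_mul (by fun_prop) (by simp [hderiv]) (cos_freq_mul hL k)
    ht).congr_deriv ?_
  rw [hderiv2, hderiv]
  simp only [mul_left_comm (u t _), integral_const_mul]
  ring

theorem snd_unique (hL : 0 < L) (h : IsVeryWeakSolution L K θ₀ u₀ θ u)
    (h' : IsVeryWeakSolution L K θ₀ u₀ θ' u') {t : ℝ} (ht : 0 ≤ t) : u' t = u t := by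
  refine sub_eq_zero.1 (eq_zero_of_forall_inner_cosMode hL fun k => ?_)
  have hode : ∀ t, 0 ≤ t → HasDerivWithinAt
      (fun t => (∫ x in Ioo 0 L, u' t x * Real.cos (freq L k * x))
        - ∫ x in Ioo 0 L, u t x * Real.cos (freq L k * x))
      (-freq L k ^ 2 * ((∫ x in Ioo 0 L, u' t x * Real.cos (freq L k * x))
        - ∫ x in Ioo 0 L, u t x * Real.cos (freq L k * x))) (Ici 0) t := by
    intro t ht
    refine ((h'.hasDerivWithinAt_integral_mul_cos_freq hL k ht).sub
      (h.hasDerivWithinAt_integral_mul_cos_freq hL k ht)).congr_deriv ?_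
    rw [h.Z_eq_mul_exp ht, h'.Z_eq_mul_exp ht]
    ring
  have hdiff := eq_mul_exp_of_hasDerivWithinAt hode ht
  rw [h.init_snd, h'.init_snd, sub_self, zero_mul] at hdiff
  rw [inner_sub_right, inner_cosMode, inner_cosMode, ← mul_sub, hdiff, mul_zero]

theorem unique (hL : 0 < L) (h : IsVeryWeakSolution L K θ₀ u₀ θ u)
    (h' : IsVeryWeakSolution L K θ₀ u₀ θ' u') {t : ℝ} (ht : 0 ≤ t) :
    θ' t = θ t ∧ u' t = u t := by
  have hu := snd_unique hL h h' ht
  have hZ := (h'.Z_eq_mul_exp ht).trans (h.Z_eq_mul_exp ht).symm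
  rw [Z, Z, hu] at hZ
  exact ⟨add_right_cancel hZ, hu⟩

end IsVeryWeakSolution

end HeatCascade

theorem theorem1 (L K : ℝ) (hL : 0 < L) (hK : K < 0)
    (hK' : ∀ κ : ℕ, K ≠ -((2 * (κ : ℝ) + 1) ^ 2 * Real.pi ^ 2 / (4 * L ^ 3))) :
    ∃ η : ℝ, 0 < η ∧ ∃ ν : ℝ, 0 < ν ∧
      ∀ (θ₀ : ℝ) (u₀ : HeatCascade.L2 L),
        ∃ (θ : ℝ → ℝ) (u : ℝ → HeatCascade.L2 L),
          HeatCascade.IsWeakSolution L K θ₀ u₀ θ u ∧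
          (∀ (θ' : ℝ → ℝ) (u' : ℝ → HeatCascade.L2 L),
            HeatCascade.IsVeryWeakSolution L K θ₀ u₀ θ' u' →
              ∀ t, 0 ≤ t → θ' t = θ t ∧ u' t = u t) ∧
          ∀ t, 0 ≤ t →
            HeatCascade.Omega L (θ t) (u t)
              ≤ η * HeatCascade.Omega L (θ 0) (u 0) * Real.exp (-ν * t) := by
  obtain ⟨η, hη, ν, hν, hdecay⟩ := HeatCascade.exists_isWeakSolution_Omega_le hL hK
    (HeatCascade.cos_sqrt_mul_ne_zero hL hK hK')
  refine ⟨η, hη, ν, hν, fun θ₀ u₀ => ?_⟩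
  obtain ⟨θ, u, hsol, hΩ⟩ := hdecay θ₀ u₀
  refine ⟨θ, u, hsol, fun θ' u' h' t ht => hsol.isVeryWeakSolution.unique hL h' ht, ?_⟩
  rwa [hsol.init_fst, hsol.init_snd]
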